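/- Let $H$ be a complex Hilbert space and let $U\in\mathcal L(H)$ be a unitary operator. Let $r,k\ge 1$ be integers, let $p_1,\dots,p_r\in\mathbb Z[X]$ be polynomials, each mapping the set $\mathbb N^+$ of positive integers into the set of nonnegative integers, and let $\alpha:\{1,\dots,k\}\to\{1,\dots,r\}$ be surjective. Let $A_1,\dots,A_k\in\mathcal L(H)$ be such that the set $\{A_kU^{-n}:n\in\mathbb N^+\}$ and, for every $1\le j\le k-1$, the set $\{A_jU^{n}:n\in\mathbb N^+\}$ are relatively compact in $\mathcal L(H)$ for the strong operator topology. Then the polynomial entangled ergodic averages $$\frac1{N^r}\sum_{n_1,\dots,n_r=1}^{N}U^{p_{\alpha(1)}(n_{\alpha(1)})}A_1\,U^{p_{\alpha(2)}(n_{\alpha(2)})}A_2\cdots U^{p_{\alpha(k)}(n_{\alpha(k)})}A_k\,U^{-\sum_{j=1}^{k}p_{\alpha(j)}(n_{\alpha(j)})}$$ converge in the strong operator topology as $N\to\infty$, that is, there is $B\in\mathcal L(H)$ to which they converge in norm at every vector of $H$. -/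

import Mathlib

/-- The integer polynomials that map positive integers to nonnegative integers. -/
def nonnegPolys : Set (Polynomial ℤ) :=
  {p | ∀ n : ℕ, 0 < n → 0 ≤ p.eval (n : ℤ)}

section

variable {H : Type*} [NormedAddCommGroup H] [InnerProductSpace ℂ H]

/-- An operator, regarded as a point of `L(H)` with the strong operator topology
(the topology of pointwise norm convergence). -/
noncomputable def toSOT (T : H →L[ℂ] H) : H →Lₚₜ[ℂ] H :=
  ContinuousLinearMap.toPointwiseConvergenceCLM ℂ (RingHom.id ℂ) H H T

/-- A set of bounded operators is relatively compact for the strong operator topology: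
its closure in `L(H)` with that topology is compact. -/
def SOTRelativelyCompact (S : Set (H →L[ℂ] H)) : Prop :=
  IsCompact (closure (toSOT '' S))

variable [CompleteSpace H]

/-- The integer power `U ^ m` of a unitary operator, as a bounded operator. -/
noncomputable def unitaryPow (U : unitary (H →L[ℂ] H)) (m : ℤ) : H →L[ℂ] H :=
  ((U ^ m : unitary (H →L[ℂ] H)) : H →L[ℂ] H)

/-- The operator
`U ^ p_{α 1}(n_{α 1}) A_1 ⋯ U ^ p_{α k}(n_{α k}) A_k U ^ (- ∑ j, p_{α j}(n_{α j}))`;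
the product is composition of operators, in this order. -/
noncomputable def entangledTerm {r k : ℕ} (U : unitary (H →L[ℂ] H))
    (p : Fin r → Polynomial ℤ) (α : Fin k → Fin r) (A : Fin k → H →L[ℂ] H)
    (n : Fin r → ℕ) : H →L[ℂ] H :=
  (List.ofFn fun j : Fin k =>
      unitaryPow U ((p (α j)).eval (n (α j) : ℤ)) * A j).prod *
    unitaryPow U (-∑ j : Fin k, (p (α j)).eval (n (α j) : ℤ))

/-- The polynomial entangled ergodic average
`N ^ (-r) ∑_{n_1, …, n_r = 1}^N` of the operators `entangledTerm U p α A n`. -/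
noncomputable def entangledAverage {r k : ℕ} (U : unitary (H →L[ℂ] H))
    (p : Fin r → Polynomial ℤ) (α : Fin k → Fin r) (A : Fin k → H →L[ℂ] H)
    (N : ℕ) : H →L[ℂ] H :=
  ((N : ℂ) ^ r)⁻¹ •
    ∑ n ∈ Fintype.piFinset (fun _ : Fin r => Finset.Icc 1 N), entangledTerm U p α A n

end

/-!
The convergence is a mean ergodic theorem for a representation of `ℤ ^ r`, reached by decoupling
the entangled product with compactness.

*Decoupling.* For a fixed vector `e`, the vectors `A U ^ m e` (with `m` running through the
exponents that occur) lie in a totally bounded set, so up to a uniformly small error they equal a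
fixed finite sum `∑ l, ⟪A† eₗ, U ^ m e⟫ • eₗ`. Replacing the innermost factor of the entangled
product in this way splits off a scalar matrix coefficient of a unitary representation and leaves a
shorter product applied to the fixed vectors `eₗ` (`IsAverageable.cauchySeq_comp`). After all
factors have been removed, the averages are those of a product of matrix coefficients times an orbit
`U ^ p i (n i) e`.

*Weights.* A product of a matrix coefficient of `σ` and an orbit of `ρ` is the image of an orbit of
`ρ ⊗ σ` under a bounded operator, so the scalar weights are absorbed by passing to tensor products
(`IsErgodicWeight.mul_coeff`). What is left is the unweighted convergence for an arbitrary unitary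
representation of `ℤ ^ r`.

*Ergodic theorem.* Averages over cubes factor into products of one-variable averages
(`exists_tendsto_finMean_piFinset`), and these converge strongly by the polynomial mean ergodic
theorem (`exists_tendsto_finMean_polynomial`), which rests on van der Corput's lemma
(`tendsto_finMean_zero_of_vanDerCorput`) and von Neumann's theorem.
-/

open Filter Topology Finset

/-! ### Averages over finite sets -/

section Mean

variable {ι E F : Type*} [NormedAddCommGroup E] [NormedSpace ℂ E]
  [NormedAddCommGroup F] [NormedSpace ℂ F]

/-- The average of `f` over the finite set `s` (zero if `s` is empty). -/
noncomputable def finMean (s : Finset ι) (f : ι → E) : E :=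
  (s.card : ℂ)⁻¹ • ∑ i ∈ s, f i

lemma finMean_add (s : Finset ι) (f g : ι → E) :
    finMean s (fun i => f i + g i) = finMean s f + finMean s g := by
  simp [finMean, sum_add_distrib]

lemma finMean_sub (s : Finset ι) (f g : ι → E) :
    finMean s (fun i => f i - g i) = finMean s f - finMean s g := by
  simp [finMean, smul_sub]

lemma finMean_sum {κ : Type*} (s : Finset ι) (t : Finset κ) (f : κ → ι → E) :
    finMean s (fun i => ∑ k ∈ t, f k i) = ∑ k ∈ t, finMean s (f k) := by
  simp only [finMean, ← smul_sum]
  rw [sum_comm]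

lemma map_finMean (L : E →L[ℂ] F) (s : Finset ι) (f : ι → E) :
    L (finMean s f) = finMean s (fun i => L (f i)) := by
  simp [finMean]

lemma finMean_congr {s : Finset ι} {f g : ι → E} (h : ∀ i ∈ s, f i = g i) :
    finMean s f = finMean s g := by
  simp only [finMean, sum_congr rfl h]

lemma finMean_const {s : Finset ι} (hs : s.Nonempty) (x : E) :
    finMean s (fun _ => x) = x := by
  have : (s.card : ℂ) ≠ 0 := by exact_mod_cast hs.card_pos.ne'
  rw [finMean, sum_const, ← Nat.cast_smul_eq_nsmul ℂ, smul_smul, inv_mul_cancel₀ this, one_smul]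

lemma norm_finMean_le (s : Finset ι) (f : ι → E) :
    ‖finMean s f‖ ≤ (s.card : ℝ)⁻¹ * ∑ i ∈ s, ‖f i‖ := by
  rw [finMean, norm_smul, norm_inv, Complex.norm_natCast]
  gcongr
  exact norm_sum_le _ _

lemma norm_finMean_le_of_forall {s : Finset ι} {f : ι → E} {C : ℝ} (hC : 0 ≤ C)
    (h : ∀ i ∈ s, ‖f i‖ ≤ C) : ‖finMean s f‖ ≤ C := by
  refine (norm_finMean_le s f).trans ?_
  rcases s.eq_empty_or_nonempty with rfl | hs
  · simpa using hC
  · have hc : (0 : ℝ) < s.card := by exact_mod_cast hs.card_pos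
    rw [inv_mul_le_iff₀ hc]
    simpa using sum_le_sum h

/-- By Cauchy--Schwarz, the squared norm of an average is at most the average squared norm. -/
lemma sq_norm_finMean_le (s : Finset ι) (f : ι → E) :
    ‖finMean s f‖ ^ 2 ≤ (s.card : ℝ)⁻¹ * ∑ i ∈ s, ‖f i‖ ^ 2 := by
  rcases s.eq_empty_or_nonempty with rfl | hs
  · simp [finMean]
  · have hc : (0 : ℝ) < s.card := by exact_mod_cast hs.card_pos
    have h1 := pow_le_pow_left₀ (norm_nonneg _) (norm_finMean_le s f) 2
    refine h1.trans ?_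
    rw [mul_pow]
    have h2 := sq_sum_le_card_mul_sum_sq (s := s) (f := fun i => ‖f i‖)
    calc ((s.card : ℝ)⁻¹) ^ 2 * (∑ i ∈ s, ‖f i‖) ^ 2
        ≤ ((s.card : ℝ)⁻¹) ^ 2 * (s.card * ∑ i ∈ s, ‖f i‖ ^ 2) := by gcongr
      _ = _ := by field_simp

/-- Convergence of averages, in Cauchy form, passes to uniform limits. -/
lemma cauchySeq_finMean_of_approx {s : ℕ → Finset ι} {f : ι → E}
    (h : ∀ ε > 0, ∃ g : ι → E, CauchySeq (fun N => finMean (s N) g) ∧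
      ∀ N, ∀ i ∈ s N, ‖f i - g i‖ ≤ ε) :
    CauchySeq (fun N => finMean (s N) f) := by
  rw [Metric.cauchySeq_iff]
  intro ε hε
  obtain ⟨g, hg, hfg⟩ := h (ε / 4) (by positivity)
  obtain ⟨N₀, hN₀⟩ := Metric.cauchySeq_iff.1 hg (ε / 4) (by positivity)
  have key : ∀ N, dist (finMean (s N) f) (finMean (s N) g) ≤ ε / 4 := fun N => by
    rw [dist_eq_norm, ← finMean_sub]
    exact norm_finMean_le_of_forall (by positivity) (hfg N)
  refine ⟨N₀, fun m hm n hn => ?_⟩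
  have h1 := dist_triangle4 (finMean (s m) f) (finMean (s m) g) (finMean (s n) g)
    (finMean (s n) f)
  have h2 := key m
  have h3 := key n
  rw [dist_comm] at h3
  have h4 := hN₀ m hm n hn
  linarith

lemma cauchySeq_map_finMean (L : E →L[ℂ] F) {s : ℕ → Finset ι} {f : ι → E}
    (h : CauchySeq (fun N => finMean (s N) f)) :
    CauchySeq (fun N => finMean (s N) (fun i => L (f i))) := by
  simp only [← map_finMean]
  exact h.map L.uniformContinuous

lemma tendsto_map_finMean_zero (L : E →L[ℂ] F) {s : ℕ → Finset ι} {f : ι → E}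
    (h : Tendsto (fun N => finMean (s N) f) atTop (𝓝 0)) :
    Tendsto (fun N => finMean (s N) (fun i => L (f i))) atTop (𝓝 0) := by
  simpa only [← map_finMean, map_zero, Function.comp_def] using (L.continuous.tendsto 0).comp h

lemma cauchySeq_finMean_sum {κ : Type*} {s : ℕ → Finset ι} (t : Finset κ) {f : κ → ι → E}
    (h : ∀ k ∈ t, CauchySeq (fun N => finMean (s N) (f k))) :
    CauchySeq (fun N => finMean (s N) (fun i => ∑ k ∈ t, f k i)) := by
  simp only [finMean_sum]
  classical
  induction t using Finset.induction_on with
  | empty => simpa using cauchySeq_const (0 : E)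
  | insert a t ha ih =>
    simp only [sum_insert ha]
    exact (h a (mem_insert_self a t)).add (ih fun k hk => h k (mem_insert_of_mem hk))

end Mean

/-! ### Van der Corput's lemma -/

section VanDerCorput

variable {E : Type*} [NormedAddCommGroup E] [InnerProductSpace ℂ E]

lemma tendsto_finMean_shift_sub {u : ℕ → E} {C : ℝ} (hu : ∀ n, ‖u n‖ ≤ C) (h : ℕ) :
    Tendsto (fun N => finMean (range N) (fun n => u (n + h)) - finMean (range N) u)
      atTop (𝓝 0) := by
  induction h with
  | zero => simp
  | succ h ih =>
    have step : Tendsto (fun N => finMean (range N) (fun n => u (n + (h + 1)))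
        - finMean (range N) (fun n => u (n + h))) atTop (𝓝 0) := by
      refine squeeze_zero_norm (a := fun N : ℕ => (N : ℝ)⁻¹ * (C + C)) (fun N => ?_) ?_
      · have e : ∑ n ∈ range N, (u (n + (h + 1)) - u (n + h)) = u (N + h) - u (0 + h) := by
          rw [← sum_range_sub (fun n => u (n + h))]
          simp only [add_assoc, add_comm 1 h]
        rw [← finMean_sub, finMean, e, norm_smul, norm_inv, card_range, Complex.norm_natCast]
        gcongr
        exact (norm_sub_le _ _).trans (add_le_add (hu _) (hu _))
      · simpa using (tendsto_inv_atTop_nhds_zero_nat (𝕜 := ℝ)).mul_const (C + C)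
    simpa using step.add ih

/-- **Van der Corput's lemma** in an inner product space: a bounded sequence whose shifts are
pairwise orthogonal on average has averages tending to zero. -/
theorem tendsto_finMean_zero_of_vanDerCorput {u : ℕ → E} {C : ℝ} (hu : ∀ n, ‖u n‖ ≤ C)
    (h : ∀ a b : ℕ, a ≠ b →
      Tendsto (fun N => finMean (range N) (fun n => inner ℂ (u (n + a)) (u (n + b))))
        atTop (𝓝 0)) :
    Tendsto (fun N => finMean (range N) u) atTop (𝓝 0) := by
  have hC : 0 ≤ C := (norm_nonneg _).trans (hu 0)
  -- `w H n` averages `H` consecutive shifts; the averages of `u` and `w H` differ by `o(1)`.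
  let w : ℕ → ℕ → E := fun H n => finMean (range H) (fun a => u (n + a))
  have hw : ∀ H, 0 < H → Tendsto (fun N => finMean (range N) (w H) - finMean (range N) u)
      atTop (𝓝 0) := fun H hH => by
    have e : ∀ N, finMean (range N) (w H) - finMean (range N) u
        = (H : ℂ)⁻¹ • ∑ a ∈ range H, (finMean (range N) (fun n => u (n + a))
            - finMean (range N) u) := fun N => by
      have h1 : finMean (range N) (w H)
          = finMean (range H) (fun a => finMean (range N) (fun n => u (n + a))) := by
        simp only [w, finMean, smul_sum]
        rw [sum_comm]
        exact sum_congr rfl fun a _ => sum_congr rfl fun n _ => smul_comm _ _ _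
      rw [h1, ← finMean_const (s := range H) (by simpa using hH.ne') (finMean (range N) u),
        ← finMean_sub, finMean_const (by simpa using hH.ne'), finMean, card_range]
    simp only [e]
    simpa using (tendsto_finsetSum (range H)
      (fun a _ => tendsto_finMean_shift_sub hu a)).const_smul ((H : ℂ)⁻¹)
  have expand : ∀ H N : ℕ, (N : ℝ)⁻¹ * ∑ n ∈ range N, ‖w H n‖ ^ 2
      = ((H : ℝ)⁻¹) ^ 2 * ∑ a ∈ range H, ∑ b ∈ range H,
        (finMean (range N) (fun n => inner ℂ (u (n + a)) (u (n + b)))).re := fun H N => by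
    have e : ∀ n, ‖w H n‖ ^ 2 = ((H : ℝ)⁻¹) ^ 2 * ∑ a ∈ range H, ∑ b ∈ range H,
        (inner ℂ (u (n + a)) (u (n + b))).re := fun n => by
      have h1 : ‖∑ a ∈ range H, u (n + a)‖ ^ 2 = ∑ a ∈ range H, ∑ b ∈ range H,
          (inner ℂ (u (n + a)) (u (n + b))).re := by
        rw [← inner_self_eq_norm_sq (𝕜 := ℂ), sum_inner]
        simp [inner_sum]
      simp only [w, finMean, norm_smul, norm_inv, card_range, Complex.norm_natCast, mul_pow, h1]
    have e2 : ∀ a b, (finMean (range N) (fun n => inner ℂ (u (n + a)) (u (n + b)))).re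
        = (N : ℝ)⁻¹ * ∑ n ∈ range N, (inner ℂ (u (n + a)) (u (n + b))).re := fun a b => by
      rw [finMean, card_range, smul_eq_mul, ← Complex.ofReal_natCast, ← Complex.ofReal_inv,
        Complex.re_ofReal_mul, Complex.re_sum]
    simp only [e, e2, ← mul_sum]
    rw [sum_comm, mul_left_comm]
    simp only [sum_comm (s := range N)]
  -- Only the `H` diagonal terms survive in the limit, each at most `C ^ 2`.
  have bound : ∀ H, 0 < H → ∀ ε > 0, ∀ᶠ N : ℕ in atTop,
      ‖finMean (range N) (w H)‖ ^ 2 ≤ (H : ℝ)⁻¹ * C ^ 2 + ε := fun H hH ε hε => by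
    have hoff : Tendsto (fun N => ((H : ℝ)⁻¹) ^ 2 * ∑ a ∈ range H, ∑ b ∈ range H,
        if a = b then 0 else
          (finMean (range N) (fun n => inner ℂ (u (n + a)) (u (n + b)))).re) atTop (𝓝 0) := by
      have : Tendsto (fun N => ∑ a ∈ range H, ∑ b ∈ range H, if a = b then 0 else
          (finMean (range N) (fun n => inner ℂ (u (n + a)) (u (n + b)))).re) atTop
          (𝓝 (∑ a ∈ range H, ∑ b ∈ range H, 0)) := by
        refine tendsto_finsetSum _ fun a _ => tendsto_finsetSum _ fun b _ => ?_
        by_cases hab : a = b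
        · simp [hab]
        · simpa [hab, Function.comp_def] using (Complex.continuous_re.tendsto 0).comp (h a b hab)
      simpa only [sum_const_zero, mul_zero] using this.const_mul (((H : ℝ)⁻¹) ^ 2)
    filter_upwards [hoff.eventually_le_const hε] with N hN
    have h1 := sq_norm_finMean_le (range N) (w H)
    rw [card_range, expand] at h1
    refine h1.trans ?_
    have hdiag : ∑ a ∈ range H, ∑ b ∈ range H,
        (finMean (range N) (fun n => inner ℂ (u (n + a)) (u (n + b)))).re
        ≤ H * C ^ 2 + ∑ a ∈ range H, ∑ b ∈ range H, if a = b then 0 else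
          (finMean (range N) (fun n => inner ℂ (u (n + a)) (u (n + b)))).re := by
      have : ∀ a ∈ range H, ∑ b ∈ range H,
          (finMean (range N) (fun n => inner ℂ (u (n + a)) (u (n + b)))).re
          ≤ C ^ 2 + ∑ b ∈ range H, if a = b then 0 else
            (finMean (range N) (fun n => inner ℂ (u (n + a)) (u (n + b)))).re := fun a ha => by
        rw [← add_sum_erase _ _ ha, ← add_sum_erase (range H) (fun b => ite _ _ _) ha]
        rw [if_pos rfl, zero_add]
        refine add_le_add ?_ (le_of_eq (sum_congr rfl fun b hb => ?_))
        · refine (Complex.re_le_norm _).trans (norm_finMean_le_of_forall (by positivity) ?_)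
          intro n _
          refine (norm_inner_le_norm _ _).trans ?_
          rw [sq]
          exact mul_le_mul (hu _) (hu _) (norm_nonneg _) hC
        · rw [if_neg (ne_of_mem_erase hb).symm]
      simpa [sum_add_distrib] using sum_le_sum this
    have hH' : (0 : ℝ) < H := by exact_mod_cast hH
    calc _ ≤ ((H : ℝ)⁻¹) ^ 2 * (H * C ^ 2 + ∑ a ∈ range H, ∑ b ∈ range H, if a = b then 0 else
          (finMean (range N) (fun n => inner ℂ (u (n + a)) (u (n + b)))).re) := by gcongr
      _ = (H : ℝ)⁻¹ * C ^ 2 + ((H : ℝ)⁻¹) ^ 2 * (∑ a ∈ range H, ∑ b ∈ range H,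
          if a = b then 0 else
          (finMean (range N) (fun n => inner ℂ (u (n + a)) (u (n + b)))).re) := by
        rw [mul_add]; congr 1; field_simp
      _ ≤ _ := by gcongr
  rw [Metric.tendsto_atTop']
  intro ε hε
  obtain ⟨H, hH0, hH⟩ : ∃ H : ℕ, 0 < H ∧ (H : ℝ)⁻¹ * C ^ 2 < (ε / 2) ^ 2 := by
    have : Tendsto (fun H : ℕ => (H : ℝ)⁻¹ * C ^ 2) atTop (𝓝 0) := by
      simpa using (tendsto_inv_atTop_nhds_zero_nat (𝕜 := ℝ)).mul_const (C ^ 2)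
    obtain ⟨H, h1, h2⟩ := ((eventually_gt_atTop 0).and
      (this.eventually_lt_const (show (0 : ℝ) < (ε / 2) ^ 2 by positivity))).exists
    exact ⟨H, h1, h2⟩
  have e1 := bound H hH0 _ (sub_pos.2 hH)
  have e2 := (hw H hH0).norm.eventually_lt_const (show ‖(0 : E)‖ < ε / 2 by simpa using hε)
  obtain ⟨N₀, hN₀⟩ := eventually_atTop.1 (e1.and e2)
  refine ⟨N₀, fun N hN => ?_⟩
  obtain ⟨h1, h2⟩ := hN₀ N hN.le
  rw [add_sub_cancel] at h1
  have h1 := (sq_le_sq₀ (norm_nonneg _) (by positivity)).1 h1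
  rw [dist_zero_right]
  have h3 := norm_sub_norm_le (finMean (range N) u) (finMean (range N) (w H))
  rw [norm_sub_rev] at h3
  linarith

end VanDerCorput

/-! ### Polynomial mean ergodic theorem for one unitary operator -/

section Rep

variable {G E : Type*} [Group G] [NormedAddCommGroup E] [InnerProductSpace ℂ E]
  {ρ : G →* (E →L[ℂ] E)}

/-- A group acting by contractions acts by isometries. -/
lemma norm_rep_apply (hρ : ∀ g, ‖ρ g‖ ≤ 1) (g : G) (x : E) : ‖ρ g x‖ = ‖x‖ := by
  refine le_antisymm (by simpa using (ρ g).le_of_opNorm_le (hρ g) x) ?_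
  have h : ρ g⁻¹ (ρ g x) = x := by
    rw [← mul_apply_eq_comp, ← map_mul]; simp
  simpa [h] using (ρ g⁻¹).le_of_opNorm_le (hρ g⁻¹) (ρ g x)

lemma inner_rep_apply (hρ : ∀ g, ‖ρ g‖ ≤ 1) (g : G) (x y : E) :
    inner ℂ (ρ g x) (ρ g y) = inner ℂ x y :=
  (LinearMap.norm_map_iff_inner_map_map (𝕜 := ℂ) (ρ g)).1 (norm_rep_apply hρ g) x y

lemma rep_mul_apply (g h : G) (x : E) : ρ (g * h) x = ρ g (ρ h x) := by
  rw [map_mul, mul_apply_eq_comp]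

end Rep

/-- The averages of a periodic sequence converge to its average over one period. -/
lemma tendsto_finMean_of_periodic {E : Type*} [NormedAddCommGroup E] [NormedSpace ℂ E]
    {u : ℕ → E} {q : ℕ} (hq : 0 < q) (hu : ∀ n, u (n + q) = u n) :
    Tendsto (fun N => finMean (range N) u) atTop (𝓝 (finMean (range q) u)) := by
  set m := finMean (range q) u with hm
  let D : ℕ → E := fun N => ∑ n ∈ range N, (u n - m)
  have hq0 : ∑ n ∈ range q, (u n - m) = 0 := by
    have : (q : ℂ) ≠ 0 := by exact_mod_cast hq.ne'
    rw [sum_sub_distrib, sum_const, card_range, hm, finMean, card_range,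
      ← Nat.cast_smul_eq_nsmul ℂ, smul_smul, mul_inv_cancel₀ this, one_smul, sub_self]
  -- The centred partial sums are periodic, hence bounded.
  have hD : Function.Periodic D q := fun N => by
    simp only [D]
    rw [add_comm N q, sum_range_add, hq0, zero_add]
    exact sum_congr rfl fun n _ => by rw [add_comm, hu]
  have hb : ∀ N, ‖D N‖ ≤ ∑ n ∈ range q, ‖D n‖ := fun N => by
    rw [← hD.map_mod_nat N]
    exact single_le_sum (f := fun n => ‖D n‖) (fun _ _ => norm_nonneg _)
      (mem_range.2 (Nat.mod_lt N hq))
  rw [tendsto_iff_norm_sub_tendsto_zero]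
  refine squeeze_zero' (g := fun N : ℕ => (N : ℝ)⁻¹ * ∑ n ∈ range q, ‖D n‖)
    (Eventually.of_forall fun _ => norm_nonneg _) ?_ ?_
  · filter_upwards [eventually_gt_atTop 0] with N hN
    rw [← finMean_const (s := range N) (by simpa using hN.ne') m, ← finMean_sub, finMean,
      norm_smul, norm_inv, card_range, Complex.norm_natCast]
    gcongr
    exact hb N
  · simpa using (tendsto_inv_atTop_nhds_zero_nat (𝕜 := ℝ)).mul_const (∑ n ∈ range q, ‖D n‖)

/-- The difference of two distinct translates of an integer polynomial of degree `d ≥ 2` has lower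
degree but is not constant: its coefficient of degree `d - 1` is nonzero. -/
lemma natDegree_taylor_sub_taylor {q : Polynomial ℤ} (hq : 2 ≤ q.natDegree) {a b : ℤ}
    (hab : a ≠ b) :
    (Polynomial.taylor a q - Polynomial.taylor b q).natDegree < q.natDegree ∧
      1 ≤ (Polynomial.taylor a q - Polynomial.taylor b q).natDegree := by
  have hc : ∀ r : ℤ, (Polynomial.taylor r q).coeff (q.natDegree - 1)
      = q.coeff (q.natDegree - 1) + q.natDegree * q.leadingCoeff * r := fun r => by
    rw [Polynomial.taylor_coeff]
    have hdeg : (Polynomial.hasseDeriv (q.natDegree - 1) q).natDegree < 2 := by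
      have := Polynomial.natDegree_hasseDeriv_le q (q.natDegree - 1)
      omega
    rw [Polynomial.eval_eq_sum_range' hdeg, sum_range_succ, sum_range_one,
      Polynomial.hasseDeriv_coeff, Polynomial.hasseDeriv_coeff]
    have h1 : 1 + (q.natDegree - 1) = q.natDegree := by omega
    have h2 : (q.natDegree).choose (q.natDegree - 1) = q.natDegree := by
      rw [Nat.choose_symm (by omega), Nat.choose_one_right]
    rw [h1, h2]
    push_cast [zero_add, pow_zero, pow_one, Nat.choose_self, one_mul, mul_one]
    rw [Polynomial.leadingCoeff]
  have hne : (Polynomial.taylor a q - Polynomial.taylor b q).coeff (q.natDegree - 1) ≠ 0 := by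
    have hl : q.leadingCoeff ≠ 0 := by
      rw [Polynomial.leadingCoeff_ne_zero]; rintro rfl; simp at hq
    have hn : (q.natDegree : ℤ) ≠ 0 := by exact_mod_cast (by omega : q.natDegree ≠ 0)
    have : (Polynomial.taylor a q - Polynomial.taylor b q).coeff (q.natDegree - 1)
        = q.natDegree * q.leadingCoeff * (a - b) := by
      rw [Polynomial.coeff_sub, hc, hc]; ring
    rw [this]
    exact mul_ne_zero (mul_ne_zero hn hl) (sub_ne_zero.2 hab)
  refine ⟨?_, by have := Polynomial.le_natDegree_of_ne_zero hne; omega⟩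
  have h0 : (Polynomial.taylor a q - Polynomial.taylor b q).coeff q.natDegree = 0 := by
    rw [Polynomial.coeff_sub, Polynomial.coeff_taylor_natDegree,
      Polynomial.coeff_taylor_natDegree, sub_self]
  refine lt_of_le_of_ne ?_ fun he => ?_
  · refine (Polynomial.natDegree_sub_le _ _).trans ?_
    simp [Polynomial.natDegree_taylor]
  · rw [← he, Polynomial.coeff_natDegree, Polynomial.leadingCoeff_eq_zero] at h0
    rw [h0] at hne
    simp at hne

section Polynomial

open Multiplicative

variable {E : Type*} [NormedAddCommGroup E] [InnerProductSpace ℂ E]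
  {V : Multiplicative ℤ →* (E →L[ℂ] E)}

/-- If the averages of `V ^ (a * n) x` vanish for every `a ≠ 0`, then so do the averages along
every nonconstant polynomial: van der Corput's lemma lowers the degree. -/
lemma tendsto_finMean_polynomial_zero (hV : ∀ g, ‖V g‖ ≤ 1) {x : E}
    (hx : ∀ a : ℤ, a ≠ 0 →
      Tendsto (fun N => finMean (range N) (fun n => V (ofAdd (a * n)) x)) atTop (𝓝 0))
    (q : Polynomial ℤ) (hq : 1 ≤ q.natDegree) :
    Tendsto (fun N => finMean (range N) (fun n => V (ofAdd (q.eval (n : ℤ))) x))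
      atTop (𝓝 0) := by
  induction hd : q.natDegree using Nat.strong_induction_on generalizing q with
  | _ d ih =>
  rcases hq.eq_or_lt with h1 | h2
  · have ha : q.coeff 1 ≠ 0 := by
      rw [h1, Polynomial.coeff_natDegree, Polynomial.leadingCoeff_ne_zero]
      rintro rfl; simp at h1
    have e : ∀ n : ℕ, V (ofAdd (q.eval (n : ℤ))) x
        = V (ofAdd (q.coeff 0)) (V (ofAdd (q.coeff 1 * n)) x) := fun n => by
      rw [← rep_mul_apply, ← ofAdd_add,
        Polynomial.eval_eq_sum_range' (show q.natDegree < 2 by omega), sum_range_succ,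
        sum_range_one]
      simp
    simp only [e]
    exact tendsto_map_finMean_zero _ (hx _ ha)
  · refine tendsto_finMean_zero_of_vanDerCorput (C := ‖x‖)
      (fun n => (norm_rep_apply hV _ x).le) fun a b hab => ?_
    have e : ∀ n : ℕ, inner ℂ (V (ofAdd (q.eval ((n + a : ℕ) : ℤ))) x)
          (V (ofAdd (q.eval ((n + b : ℕ) : ℤ))) x)
        = innerSL ℂ x (V (ofAdd ((Polynomial.taylor (b : ℤ) q
            - Polynomial.taylor (a : ℤ) q).eval (n : ℤ))) x) := fun n => by
      rw [innerSL_apply_apply, ← inner_rep_apply hV (ofAdd (q.eval ((n + a : ℕ) : ℤ))) x,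
        ← rep_mul_apply, ← ofAdd_add]
      congr 4
      rw [Polynomial.eval_sub, Polynomial.taylor_eval, Polynomial.taylor_eval]
      push_cast
      ring
    have hdeg := natDegree_taylor_sub_taylor (q := q) h2 (a := b) (b := a)
      (by exact_mod_cast hab.symm)
    simp only [e]
    exact tendsto_map_finMean_zero _ (ih _ (hd ▸ hdeg.1) _ hdeg.2 rfl)

variable [CompleteSpace E]

/-- **Polynomial mean ergodic theorem.** Vectors fixed by some nonzero power of `V` have periodic
polynomial orbits; on the orthogonal complement of their span every nonzero power of `V` is
ergodic, and the averages along nonconstant polynomials vanish. -/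
theorem exists_tendsto_finMean_polynomial (hV : ∀ g, ‖V g‖ ≤ 1) (q : Polynomial ℤ) (x : E) :
    ∃ y, Tendsto (fun N => finMean (range N) (fun n => V (ofAdd (q.eval (n : ℤ))) x))
      atTop (𝓝 y) := by
  rcases Nat.eq_zero_or_pos q.natDegree with h0 | hpos
  · refine ⟨V (ofAdd (q.coeff 0)) x, tendsto_const_nhds.congr' ?_⟩
    filter_upwards [eventually_gt_atTop 0] with N hN
    rw [Polynomial.eq_C_of_natDegree_eq_zero h0]
    simp [finMean_const (s := range N) (by simpa using hN.ne')]
  -- The space of vectors whose averages converge is a closed subspace.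
  let S : Submodule ℂ E :=
    { carrier := {x | CauchySeq
        (fun N => finMean (range N) (fun n => V (ofAdd (q.eval (n : ℤ))) x))}
      add_mem' := fun {a b} ha hb => by
        simp only [Set.mem_ofPred_eq, map_add, finMean_add] at ha hb ⊢
        exact ha.add hb
      zero_mem' := by simpa [finMean] using cauchySeq_const (0 : E)
      smul_mem' := fun c a ha => by
        have := cauchySeq_map_finMean (c • ContinuousLinearMap.id ℂ E) ha
        simpa using this }
  have hS : IsClosed (S : Set E) := by
    refine isClosed_of_closure_subset fun z hz => ?_
    refine cauchySeq_finMean_of_approx fun ε hε => ?_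
    obtain ⟨z', hz', hd⟩ := Metric.mem_closure_iff.1 hz ε hε
    refine ⟨_, hz', fun N n _ => ?_⟩
    rw [← map_sub, norm_rep_apply hV, ← dist_eq_norm]
    exact hd.le
  let K : Submodule ℂ E := ⨆ a : {a : ℤ // a ≠ 0}, (V (ofAdd (a : ℤ))).eqLocus 1
  have hK : K ≤ S := iSup_le fun ⟨a, ha⟩ z hz => by
    have hfix : V (ofAdd a) z = z := hz
    -- A vector fixed by `V ^ a` is fixed by `V ^ (a * m)` for every integer `m`.
    have hfix' : ∀ m : ℤ, V (ofAdd (a * m)) z = z := fun m => by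
      have hinv : V (ofAdd (-a)) z = z := by
        conv_lhs => rw [← hfix]
        rw [← rep_mul_apply, ← ofAdd_add]; simp
      induction m using Int.induction_on with
      | zero => simp
      | succ i ih => rw [mul_add, mul_one, ofAdd_add, rep_mul_apply, hfix, ih]
      | pred i ih => rw [mul_sub, mul_one, sub_eq_add_neg, ofAdd_add, rep_mul_apply, hinv, ih]
    refine (tendsto_finMean_of_periodic (q := a.natAbs) (Int.natAbs_pos.2 ha)
      fun n => ?_).cauchySeq
    have hdvd : a ∣ q.eval ((n + a.natAbs : ℕ) : ℤ) - q.eval (n : ℤ) := by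
      refine dvd_trans ?_ (Polynomial.sub_dvd_eval_sub _ _ q)
      simp
    obtain ⟨m, hm⟩ := hdvd
    rw [show q.eval ((n + a.natAbs : ℕ) : ℤ) = q.eval (n : ℤ) + a * m by linarith,
      ofAdd_add, rep_mul_apply, hfix']
  have hKo : Kᗮ ≤ S := fun z hz => by
    refine (tendsto_finMean_polynomial_zero hV (fun a ha => ?_) q hpos).cauchySeq
    have h1 := (V (ofAdd a)).tendsto_birkhoffAverage_orthogonalProjection (hV _) z
    have h2 : ((V (ofAdd a)).eqLocus (1 : E →L[ℂ] E)).orthogonalProjectionOnto z = 0 := by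
      rw [Submodule.orthogonalProjectionOnto_eq_zero_iff]
      exact Submodule.orthogonal_le (le_iSup
        (fun a : {a : ℤ // a ≠ 0} => (V (ofAdd (a : ℤ))).eqLocus 1) ⟨a, ha⟩) hz
    rw [h2] at h1
    refine h1.congr fun N => ?_
    simp only [birkhoffAverage, birkhoffSum, finMean, card_range, id]
    congr 1
    refine sum_congr rfl fun n _ => ?_
    rw [← FunLike.coe_pow_eq_iterate, ← map_pow, ← ofAdd_nsmul, nsmul_eq_mul, mul_comm]
  have htop : S = ⊤ := by
    have : CompleteSpace K.topologicalClosure := K.isClosed_topologicalClosure.completeSpace_coe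
    rw [eq_top_iff, ← Submodule.sup_orthogonal_of_hasOrthogonalProjection
      (K := K.topologicalClosure), Submodule.orthogonal_closure]
    exact sup_le (K.topologicalClosure_minimal hK hS) hKo
  have hxS : x ∈ S := htop ▸ Submodule.mem_top
  exact cauchySeq_tendsto_of_complete hxS

end Polynomial

/-! ### Averages over boxes for several commuting unitaries -/

section Box

open Multiplicative

lemma finMean_Icc_one {E : Type*} [NormedAddCommGroup E] [NormedSpace ℂ E] (N : ℕ)
    (f : ℕ → E) : finMean (Icc 1 N) f = finMean (range N) (fun n => f (n + 1)) := by
  have h : Icc 1 N = (range N).map (addRightEmbedding 1) := by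
    ext n
    simp only [mem_Icc, Finset.mem_map, mem_range, addRightEmbedding_apply]
    exact ⟨fun h => ⟨n - 1, by omega, by omega⟩, by rintro ⟨m, hm, rfl⟩; omega⟩
  rw [h, finMean, finMean, card_map, sum_map]
  rfl

/-- The averages over the boxes `∏ i, s i N` of a representation of a commutative group along a
product of one-variable sequences are products of one-variable averages, so that strong
convergence of the latter gives convergence of the former. The factorization is carried out in
the commutative group algebra. -/
theorem exists_tendsto_finMean_piFinset {ι G E : Type*} [Fintype ι] [DecidableEq ι] [CommGroup G]
    [NormedAddCommGroup E] [InnerProductSpace ℂ E] {ρ : G →* (E →L[ℂ] E)}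
    (hρ : ∀ g, ‖ρ g‖ ≤ 1) (s : ι → ℕ → Finset ℕ) (g : ι → ℕ → G)
    (h : ∀ i x, ∃ y, Tendsto (fun N => finMean (s i N) (fun n => ρ (g i n) x)) atTop (𝓝 y))
    (x : E) :
    ∃ y, Tendsto (fun N => finMean (Fintype.piFinset fun i => s i N)
      (fun n => ρ (∏ i, g i (n i)) x)) atTop (𝓝 y) := by
  let Φ : MonoidAlgebra ℂ G →ₐ[ℂ] (E →L[ℂ] E) := MonoidAlgebra.lift ℂ (E →L[ℂ] E) G ρ
  let M : ι → ℕ → MonoidAlgebra ℂ G := fun i N =>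
    ((s i N).card : ℂ)⁻¹ • ∑ n ∈ s i N, MonoidAlgebra.of ℂ G (g i n)
  have hΦ : ∀ a, Φ (MonoidAlgebra.of ℂ G a) = ρ a := fun a => by simp [Φ]
  have hM : ∀ i N y, Φ (M i N) y = finMean (s i N) (fun n => ρ (g i n) y) := fun i N y => by
    simp only [M, map_smul, map_sum, hΦ, finMean, smul_apply,
      _root_.sum_apply]
  have hM1 : ∀ i N y, ‖Φ (M i N) y‖ ≤ ‖y‖ := fun i N y => by
    rw [hM]
    exact norm_finMean_le_of_forall (norm_nonneg _) fun n _ => (norm_rep_apply hρ _ _).le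
  have key : ∀ S : Finset ι, ∃ y, Tendsto (fun N => Φ (∏ i ∈ S, M i N) x) atTop (𝓝 y) := by
    intro S
    induction S using Finset.induction_on with
    | empty => exact ⟨x, by simp⟩
    | insert i S hi ih =>
      obtain ⟨z, hz⟩ := ih
      obtain ⟨y, hy⟩ := h i z
      refine ⟨y, ?_⟩
      have e : ∀ N, Φ (∏ j ∈ insert i S, M j N) x
          = Φ (M i N) (Φ (∏ j ∈ S, M j N) x - z) + finMean (s i N) (fun n => ρ (g i n) z) :=
        fun N => by
          rw [prod_insert hi, map_mul, mul_apply_eq_comp, ← hM, map_sub, sub_add_cancel]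
      simp only [e]
      have h0 : Tendsto (fun N => Φ (M i N) (Φ (∏ j ∈ S, M j N) x - z)) atTop (𝓝 0) :=
        squeeze_zero_norm (fun N => hM1 i N _) (tendsto_iff_norm_sub_tendsto_zero.1 hz)
      simpa using h0.add hy
  obtain ⟨y, hy⟩ := key univ
  refine ⟨y, hy.congr fun N => ?_⟩
  simp only [M, prod_smul, prod_univ_sum]
  rw [map_smul, map_sum, finMean, Fintype.card_piFinset, smul_apply,
    _root_.sum_apply, prod_inv_distrib]
  push_cast
  congr 1
  refine sum_congr rfl fun n _ => ?_
  rw [← map_prod, hΦ]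

/-- The lattice point `(p i (n i))ᵢ`, in multiplicative notation. -/
def polyPoint {ι : Type*} (p : ι → Polynomial ℤ) (n : ι → ℕ) : Multiplicative (ι → ℤ) :=
  ofAdd fun i => (p i).eval (n i : ℤ)

/-- The cube `{1, …, N} ^ ι`. -/
def cube (ι : Type*) [Fintype ι] [DecidableEq ι] (N : ℕ) : Finset (ι → ℕ) :=
  Fintype.piFinset fun _ => Icc 1 N

variable {ι : Type*} [Fintype ι] [DecidableEq ι]

theorem exists_tendsto_finMean_cube {E : Type*} [NormedAddCommGroup E] [InnerProductSpace ℂ E]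
    [CompleteSpace E] {ρ : Multiplicative (ι → ℤ) →* (E →L[ℂ] E)} (hρ : ∀ g, ‖ρ g‖ ≤ 1)
    (p : ι → Polynomial ℤ) (x : E) :
    ∃ y, Tendsto (fun N => finMean (cube ι N) (fun n => ρ (polyPoint p n) x)) atTop (𝓝 y) := by
  let e : ι → ℤ →+ (ι → ℤ) := fun i => AddMonoidHom.single (fun _ => ℤ) i
  obtain ⟨y, hy⟩ := exists_tendsto_finMean_piFinset hρ (fun _ : ι => Icc 1)
    (fun i n => ofAdd (e i ((p i).eval (n : ℤ)))) (fun i x => by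
      obtain ⟨y, hy⟩ := exists_tendsto_finMean_polynomial
        (V := ρ.comp (AddMonoidHom.toMultiplicative (e i))) (fun g => hρ _)
        -- The translate by one accounts for averages starting at `1` rather than `0`.
        (Polynomial.taylor 1 (p i)) x
      refine ⟨y, hy.congr fun N => ?_⟩
      rw [finMean_Icc_one]
      simp [Polynomial.taylor_eval]) x
  refine ⟨y, hy.congr fun N => finMean_congr fun n _ => ?_⟩
  congr 2
  rw [← ofAdd_sum, polyPoint]
  congr 1
  exact Finset.univ_sum_single _

/-- Without completeness the averages still form a Cauchy sequence: the representation extends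
to the completion. -/
theorem cauchySeq_finMean_cube {E : Type*} [NormedAddCommGroup E] [InnerProductSpace ℂ E]
    {ρ : Multiplicative (ι → ℤ) →* (E →L[ℂ] E)} (hρ : ∀ g, ‖ρ g‖ ≤ 1)
    (p : ι → Polynomial ℤ) (x : E) :
    CauchySeq (fun N => finMean (cube ι N) (fun n => ρ (polyPoint p n) x)) := by
  let J : E →ₗᵢ[ℂ] UniformSpace.Completion E := UniformSpace.Completion.toComplₗᵢ
  let ρ' : Multiplicative (ι → ℤ) →*
      (UniformSpace.Completion E →L[ℂ] UniformSpace.Completion E) :=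
    { toFun := fun g => (ρ g).completion
      map_one' := by
        ext z
        induction z using UniformSpace.Completion.induction_on with
        | hp => exact isClosed_eq (by fun_prop) (by fun_prop)
        | ih a => simp
      map_mul' := fun g h => by
        ext z
        induction z using UniformSpace.Completion.induction_on with
        | hp => exact isClosed_eq (by fun_prop) (by fun_prop)
        | ih a => simp }
  have hρ' : ∀ g, ‖ρ' g‖ ≤ 1 := fun g => by
    refine ContinuousLinearMap.opNorm_le_bound _ zero_le_one fun z => ?_
    induction z using UniformSpace.Completion.induction_on with
    | hp => exact isClosed_le (by fun_prop) (by fun_prop)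
    | ih a =>
      have : ρ' g a = ((ρ g a : E) : UniformSpace.Completion E) := by simp [ρ']
      rw [this, UniformSpace.Completion.norm_coe, UniformSpace.Completion.norm_coe]
      exact (ρ g).le_of_opNorm_le (hρ g) a
  obtain ⟨y, hy⟩ := exists_tendsto_finMean_cube hρ' p (J x)
  have e : ∀ N, finMean (cube ι N) (fun n => ρ' (polyPoint p n) (J x))
      = J (finMean (cube ι N) (fun n => ρ (polyPoint p n) x)) := fun N => by
    refine Eq.trans ?_ (map_finMean J.toContinuousLinearMap _ _).symm
    exact finMean_congr fun n _ => by simp [ρ', J]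
  simp only [e] at hy
  exact J.isometry.isUniformInducing.cauchy_map_iff.1 hy.cauchySeq

end Box

/-! ### Weights preserving convergence of averages -/

section Weights

universe u

variable {ι : Type*} [Fintype ι] [DecidableEq ι]

/-- A bounded weight `c` on `ℕ ^ ι` is ergodic along `p` if the averages over cubes of
`c n • ρ (p n) x` are Cauchy for every unitary representation `ρ` of `ℤ ^ ι` on an inner product
space and every vector `x`. Unitarity is expressed by contractivity, which for a group suffices
(`norm_rep_apply`). Completeness is not required, so that algebraic tensor products are
allowed. -/
structure IsErgodicWeight (p : ι → Polynomial ℤ) (c : (ι → ℕ) → ℂ) : Prop where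
  bounded : ∃ C, ∀ n, ‖c n‖ ≤ C
  cauchySeq : ∀ (E : Type u) [NormedAddCommGroup E] [InnerProductSpace ℂ E]
    (ρ : Multiplicative (ι → ℤ) →* (E →L[ℂ] E)), (∀ g, ‖ρ g‖ ≤ 1) → ∀ x : E,
    CauchySeq (fun N => finMean (cube ι N) (fun n => c n • ρ (polyPoint p n) x))

lemma isErgodicWeight_one (p : ι → Polynomial ℤ) :
    IsErgodicWeight.{u} p (fun _ => 1) where
  bounded := ⟨1, fun _ => by simp⟩
  cauchySeq E _ _ ρ hρ x := by simpa using cauchySeq_finMean_cube hρ p x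

open TensorProduct in
/-- Multiplying by a matrix coefficient of a unitary representation preserves ergodic weights:
the product of a coefficient of `σ` with an orbit of `ρ` is a contraction of an orbit of
`ρ ⊗ σ`. -/
lemma IsErgodicWeight.mul_coeff {p : ι → Polynomial ℤ} {c : (ι → ℕ) → ℂ}
    (hc : IsErgodicWeight.{u} p c) {H : Type u} [NormedAddCommGroup H] [InnerProductSpace ℂ H]
    {σ : Multiplicative (ι → ℤ) →* (H →L[ℂ] H)} (hσ : ∀ g, ‖σ g‖ ≤ 1) (a b : H) :
    IsErgodicWeight.{u} p (fun n => c n * inner ℂ b (σ (polyPoint p n) a)) where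
  bounded := by
    obtain ⟨C, hC⟩ := hc.bounded
    refine ⟨C * (‖b‖ * ‖a‖), fun n => ?_⟩
    rw [norm_mul]
    refine mul_le_mul (hC n) ?_ (norm_nonneg _) ((norm_nonneg _).trans (hC n))
    simpa [norm_rep_apply hσ] using norm_inner_le_norm (𝕜 := ℂ) b (σ (polyPoint p n) a)
  cauchySeq E _ _ ρ hρ x := by
    let τ : Multiplicative (ι → ℤ) →* (E ⊗[ℂ] H →L[ℂ] E ⊗[ℂ] H) :=
      { toFun := fun g => TensorProduct.mapL (ρ g) (σ g)
        map_one' := by rw [map_one, map_one]; exact TensorProduct.mapL_id_id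
        map_mul' := fun g h => by rw [map_mul, map_mul, TensorProduct.mapL_mul] }
    have hτ : ∀ g, ‖τ g‖ ≤ 1 := fun g =>
      (TensorProduct.norm_mapL_le (ρ g) (σ g)).trans (mul_le_one₀ (hρ g) (norm_nonneg _) (hσ g))
    let L : E ⊗[ℂ] H →L[ℂ] E :=
      ((TensorProduct.ridIsometry ℂ E).toContinuousLinearEquiv : E ⊗[ℂ] ℂ →L[ℂ] E).comp
        ((innerSL ℂ b).lTensor E)
    convert cauchySeq_map_finMean L (hc.cauchySeq (E ⊗[ℂ] H) τ hτ (x ⊗ₜ a)) using 4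
    simp [L, τ, smul_smul]

end Weights

/-! ### Entangled products and compactness -/

lemma totallyBounded_setOf_nat_of_pos {E : Type*} [UniformSpace E] {f : ℕ → E}
    (h : TotallyBounded {z | ∃ m : ℕ, 0 < m ∧ z = f m}) :
    TotallyBounded {z | ∃ m : ℕ, z = f m} := by
  refine ((Set.finite_singleton (f 0)).totallyBounded.union h).subset ?_
  rintro _ ⟨m, rfl⟩
  rcases Nat.eq_zero_or_pos m with rfl | hm
  · exact Or.inl rfl
  · exact Or.inr ⟨m, hm, rfl⟩

section Entangled

universe u

open Multiplicative

variable {H : Type u} [NormedAddCommGroup H] [InnerProductSpace ℂ H]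

/-- A totally bounded set is uniformly approximated by a finite-rank projection, written out in an
orthonormal basis of its range. -/
lemma TotallyBounded.exists_norm_sub_sum_inner_le {K : Set H} (hK : TotallyBounded K) {ε : ℝ}
    (hε : 0 < ε) : ∃ (m : ℕ) (e : Fin m → H), ∀ y ∈ K,
      ‖y - ∑ l, inner ℂ (e l) y • e l‖ ≤ ε := by
  obtain ⟨t, ht, hKt⟩ := Metric.totallyBounded_iff.1 hK ε hε
  have : FiniteDimensional ℂ (Submodule.span ℂ t) := FiniteDimensional.span_of_finite ℂ ht
  let b := stdOrthonormalBasis ℂ (Submodule.span ℂ t)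
  refine ⟨_, fun l => b l, fun y hy => ?_⟩
  obtain ⟨z, hz, hyz⟩ := Set.mem_iUnion₂.1 (hKt hy)
  have hsum : ∑ l, inner ℂ (b l : H) y • (b l : H)
      = (Submodule.span ℂ t).starProjection y := by
    rw [Submodule.starProjection_apply, b.orthogonalProjectionOnto_apply_eq_sum]
    simp
  rw [hsum, Submodule.starProjection_minimal]
  refine (ciInf_le ⟨0, by rintro _ ⟨w, rfl⟩; exact norm_nonneg _⟩
    ⟨z, Submodule.subset_span hz⟩).trans ?_
  rw [← dist_eq_norm]
  exact (Metric.mem_ball.1 hyz).le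

lemma SOTRelativelyCompact.totallyBounded_apply {S : Set (H →L[ℂ] H)}
    (hS : SOTRelativelyCompact S) (y : H) : TotallyBounded ((fun T : H →L[ℂ] H => T y) '' S) := by
  have h : IsCompact ((fun T : H →Lₚₜ[ℂ] H => T y) '' closure (toSOT '' S)) :=
    IsCompact.image hS (continuous_eval_const y)
  refine h.totallyBounded.subset ?_
  rintro _ ⟨T, hT, rfl⟩
  exact ⟨toSOT T, subset_closure ⟨T, hT, rfl⟩, rfl⟩

variable [CompleteSpace H] (U : unitary (H →L[ℂ] H))

lemma unitaryPow_zero : unitaryPow U 0 = 1 := by simp [unitaryPow]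

lemma unitaryPow_add (a b : ℤ) : unitaryPow U (a + b) = unitaryPow U a * unitaryPow U b := by
  simp [unitaryPow, zpow_add]

lemma norm_unitaryPow_le (a : ℤ) : ‖unitaryPow U a‖ ≤ 1 := by
  refine ContinuousLinearMap.opNorm_le_bound _ zero_le_one fun x => ?_
  rw [one_mul, unitaryPow, Unitary.norm_map]

/-- The representation `v ↦ U ^ φ v` of `ℤ ^ ι` attached to a unitary operator and an additive
functional `φ`. -/
noncomputable def powRep {ι : Type*} (φ : (ι → ℤ) →+ ℤ) :
    Multiplicative (ι → ℤ) →* (H →L[ℂ] H) where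
  toFun g := unitaryPow U (φ g.toAdd)
  map_one' := by simp [unitaryPow_zero]
  map_mul' g h := by simp [unitaryPow_add]

variable {ι : Type*} [Fintype ι] [DecidableEq ι] (p : ι → Polynomial ℤ)

/-- A family of operators indexed by `ℕ ^ ι` is averageable if its values on the orbits
`U ^ p i (n i) e` have Cauchy averages, even after multiplication by an ergodic weight. -/
structure IsAverageable (Q : (ι → ℕ) → H →L[ℂ] H) : Prop where
  bounded : ∃ B, ∀ n, ‖Q n‖ ≤ B
  cauchySeq : ∀ c : (ι → ℕ) → ℂ, IsErgodicWeight.{u} p c → ∀ i e, CauchySeq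
    (fun N => finMean (cube ι N)
      (fun n => c n • Q n (unitaryPow U ((p i).eval (n i : ℤ)) e)))

variable {U p}

lemma isAverageable_one : IsAverageable U p (fun _ => 1) where
  bounded := ⟨1, fun _ => ContinuousLinearMap.norm_id_le⟩
  cauchySeq _ hc i e := hc.cauchySeq H (powRep U (Pi.evalAddMonoidHom (fun _ => ℤ) i))
    (fun _ => norm_unitaryPow_le U _) e

/-- A factor `A` that maps the orbit of `y` into a totally bounded set decouples an entangled
product: up to a uniformly small error the vector
`A (σ (p n) y)` is a fixed finite combination of vectors whose coefficients are matrix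
coefficients of `σ`, and such coefficients are absorbed by the ergodic weight. -/
lemma IsAverageable.cauchySeq_comp {Q : (ι → ℕ) → H →L[ℂ] H} (hQ : IsAverageable U p Q)
    {c : (ι → ℕ) → ℂ} (hc : IsErgodicWeight.{u} p c) (i : ι) (A : H →L[ℂ] H)
    {σ : Multiplicative (ι → ℤ) →* (H →L[ℂ] H)} (hσ : ∀ g, ‖σ g‖ ≤ 1) (y : H)
    (hK : TotallyBounded {z | ∃ N, ∃ n ∈ cube ι N, z = A (σ (polyPoint p n) y)}) :
    CauchySeq (fun N => finMean (cube ι N)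
      (fun n => c n • Q n (unitaryPow U ((p i).eval (n i : ℤ)) (A (σ (polyPoint p n) y))))) := by
  obtain ⟨C, hC⟩ := hc.bounded
  obtain ⟨B, hB⟩ := hQ.bounded
  have hC0 : 0 ≤ C := (norm_nonneg _).trans (hC fun _ => 0)
  have hB0 : 0 ≤ B := (norm_nonneg _).trans (hB fun _ => 0)
  refine cauchySeq_finMean_of_approx fun ε hε => ?_
  obtain ⟨m, e, he⟩ := hK.exists_norm_sub_sum_inner_le (ε := ε / (C * B + 1)) (by positivity)
  refine ⟨fun n => ∑ l, (c n * inner ℂ (ContinuousLinearMap.adjoint A (e l))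
    (σ (polyPoint p n) y)) • Q n (unitaryPow U ((p i).eval (n i : ℤ)) (e l)),
    cauchySeq_finMean_sum _ fun l _ => hQ.cauchySeq _ (hc.mul_coeff hσ y _) i (e l),
    fun N n hn => ?_⟩
  set z := A (σ (polyPoint p n) y) with hz
  have hzK := he z ⟨N, n, hn, rfl⟩
  have hdiff : c n • Q n (unitaryPow U ((p i).eval (n i : ℤ)) z)
      - ∑ l, (c n * inner ℂ (ContinuousLinearMap.adjoint A (e l)) (σ (polyPoint p n) y)) •
        Q n (unitaryPow U ((p i).eval (n i : ℤ)) (e l))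
      = c n • Q n (unitaryPow U ((p i).eval (n i : ℤ)) (z - ∑ l, inner ℂ (e l) z • e l)) := by
    simp only [ContinuousLinearMap.adjoint_inner_left, ← hz, map_sub, map_sum, map_smul, smul_sub,
      smul_sum, smul_smul]
  rw [hdiff, norm_smul]
  calc ‖c n‖ * ‖Q n (unitaryPow U ((p i).eval (n i : ℤ)) (z - ∑ l, inner ℂ (e l) z • e l))‖
      ≤ C * (B * (ε / (C * B + 1))) := by
        gcongr
        · exact hC n
        · refine (Q n).le_of_opNorm_le_of_le (hB n) ?_
          simpa using (unitaryPow U _).le_of_opNorm_le_of_le (norm_unitaryPow_le U _) hzK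
    _ = ε * ((C * B) / (C * B + 1)) := by ring
    _ ≤ ε * 1 := by
        gcongr
        rw [div_le_one (by positivity)]
        linarith
    _ = ε := mul_one ε

lemma exists_natCast_eval_of_mem_cube (hp : ∀ i, p i ∈ nonnegPolys) {N : ℕ} {n : ι → ℕ}
    (hn : n ∈ cube ι N) (i : ι) : ∃ m : ℕ, (p i).eval (n i : ℤ) = m := by
  have h1 := Fintype.mem_piFinset.1 hn i
  exact Int.eq_ofNat_of_zero_le (hp i (n i) (mem_Icc.1 h1).1)

/-- Products of factors `U ^ p i (n i) * A`, where `A U ^ m y` stays in a compact set as `m ≥ 0`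
varies, are averageable. -/
lemma isAverageable_list_prod (hp : ∀ i, p i ∈ nonnegPolys) (L : List (ι × (H →L[ℂ] H)))
    (hL : ∀ q ∈ L, ∀ y, TotallyBounded {z | ∃ m : ℕ, z = q.2 (unitaryPow U m y)}) :
    IsAverageable U p (fun n =>
      (L.map fun q => unitaryPow U ((p q.1).eval (n q.1 : ℤ)) * q.2).prod) := by
  induction L using List.reverseRecOn with
  | nil => simpa using isAverageable_one
  | append_singleton L q ih =>
    have hQ := ih fun q' hq' => hL q' (by simp [hq'])
    obtain ⟨B, hB⟩ := hQ.bounded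
    have hB0 : 0 ≤ B := (norm_nonneg _).trans (hB fun _ => 0)
    simp only [List.map_append, List.prod_append, List.map_singleton, List.prod_singleton]
    refine ⟨⟨B * (1 * ‖q.2‖), fun n => ?_⟩, fun c hc i e => ?_⟩
    · refine (norm_mul_le _ _).trans (mul_le_mul (hB n) ?_ (norm_nonneg _) hB0)
      exact (norm_mul_le _ _).trans (by gcongr; exact norm_unitaryPow_le U _)
    · refine hQ.cauchySeq_comp hc q.1 q.2
        (σ := powRep U (Pi.evalAddMonoidHom (fun _ => ℤ) i)) (fun _ => norm_unitaryPow_le U _) e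
        ((hL q (by simp) e).subset ?_)
      rintro _ ⟨N, n, hn, rfl⟩
      obtain ⟨m, hm⟩ := exists_natCast_eval_of_mem_cube hp hn i
      exact ⟨m, by rw [← hm]; rfl⟩

end Entangled

theorem mainTheorem3 {H : Type*} [NormedAddCommGroup H] [InnerProductSpace ℂ H]
    [CompleteSpace H] (U : unitary (H →L[ℂ] H)) {r k : ℕ} (hk : 0 < k)
    (p : Fin r → Polynomial ℤ) (hp : ∀ i, p i ∈ nonnegPolys)
    (α : Fin k → Fin r) (hα : Function.Surjective α)
    (A : Fin k → H →L[ℂ] H)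
    (hlast : SOTRelativelyCompact
      {T : H →L[ℂ] H | ∃ n : ℕ, 0 < n ∧
        T = A ⟨k - 1, Nat.sub_lt hk Nat.one_pos⟩ * unitaryPow U (-(n : ℤ))})
    (hbefore : ∀ j : Fin k, (j : ℕ) < k - 1 → SOTRelativelyCompact
      {T : H →L[ℂ] H | ∃ n : ℕ, 0 < n ∧ T = A j * unitaryPow U (n : ℤ)}) :
    ∃ B : H →L[ℂ] H, Filter.Tendsto
      (fun N : ℕ => toSOT (entangledAverage U p α A N)) Filter.atTop (nhds (toSOT B)) := by
  obtain ⟨k, rfl⟩ := Nat.exists_eq_add_one.2 hk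
  let L : List (Fin r × (H →L[ℂ] H)) := List.ofFn fun j : Fin k => (α j.castSucc, A j.castSucc)
  have hL : ∀ q ∈ L, ∀ y, TotallyBounded {z | ∃ m : ℕ, z = q.2 (unitaryPow U m y)} := by
    intro q hq y
    obtain ⟨j, rfl⟩ := (List.mem_ofFn' _ _).1 hq
    refine totallyBounded_setOf_nat_of_pos (f := fun m => A j.castSucc (unitaryPow U m y))
      (((hbefore j.castSucc (by simp)).totallyBounded_apply y).subset ?_)
    rintro _ ⟨m, hm, rfl⟩
    exact ⟨_, ⟨m, hm, rfl⟩, rfl⟩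
  have hQ := isAverageable_list_prod hp L hL
  let φ : (Fin r → ℤ) →+ ℤ :=
    -∑ j : Fin (k + 1), Pi.evalAddMonoidHom (fun _ => ℤ) (α j)
  have hφ : ∀ n, powRep U φ (polyPoint p n)
      = unitaryPow U (-∑ j, (p (α j)).eval (n (α j) : ℤ)) := fun n => by
    simp [powRep, φ, polyPoint]
  -- The rightmost factor is decoupled along `U ^ (-∑ j, p (α j) (n (α j)))`, the other factors are
  -- those of the averageable product over `L`.
  have hconv : ∀ x, CauchySeq (fun N => entangledAverage U p α A N x) := fun x => by
    have h1 := hQ.cauchySeq_comp (isErgodicWeight_one p) (α (Fin.last k)) (A (Fin.last k))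
      (σ := powRep U φ) (fun _ => norm_unitaryPow_le U _) x (by
        refine TotallyBounded.subset ?_ (totallyBounded_setOf_nat_of_pos
          (f := fun m => A (Fin.last k) (unitaryPow U (-(m : ℤ)) x))
          ((hlast.totallyBounded_apply x).subset ?_))
        · rintro _ ⟨N, n, hn, rfl⟩
          choose m hm using exists_natCast_eval_of_mem_cube hp hn
          refine ⟨∑ j, m (α j), ?_⟩
          rw [hφ]
          simp [hm]
        · rintro _ ⟨m, hm, rfl⟩
          exact ⟨_, ⟨m, hm, rfl⟩, rfl⟩)
    convert h1 using 2 with N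
    rw [entangledAverage, finMean, smul_apply, _root_.sum_apply, cube]
    congr 1
    · simp [Fintype.card_piFinset]
    · refine sum_congr rfl fun n _ => ?_
      rw [entangledTerm, List.ofFn_succ', List.concat_eq_append, List.prod_append,
        List.prod_singleton, hφ, one_smul, List.map_ofFn]
      rfl
  choose y hy using fun x => cauchySeq_tendsto_of_complete (hconv x)
  refine ⟨continuousLinearMapOfTendsto (entangledAverage U p α A) (f := y)
    (tendsto_pi_nhds.2 hy), ?_⟩
  rw [PointwiseConvergenceCLM.tendsto_iff_forall_tendsto]
  exact hy
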